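/- **Definitions.** Let $k$ be a field. For a commutative ring $R$ and an integer $n\ge 0$, let $\mathcal F_n(R)$ be the set of pointed rational functions of degree $n$ over $R$: pairs $\frac AB=(A,B)$ of polynomials in $R[X]$ with $A$ monic of degree $n$, $\deg B<n$ and $\mathrm{res}_{n,n}(A,B)\in R^\times$ (the resultant of $A,B$ regarded as polynomials of degree $\le n$); $\mathcal F_0(R)$ consists of the single element $\frac10$. Put $\mathcal F=\coprod_{n\ge0}\mathcal F_n$. Each $\frac AB\in\mathcal F_n(R)$ has a unique pair $(U,V)$ of polynomials in $R[X]$ with $AU+BV=1$, $\deg U\le n-2$ and $\deg V\le n-1$ (for $n=0$ this is to be read as $(U,V)=(1,0)$). For $\frac{A_i}{B_i}\in\mathcal F_{n_i}(R)$ with associated pairs $(U_i,V_i)$, $i=1,2$, set $\frac{A_1}{B_1}\oplus^{\mathrm N}\frac{A_2}{B_2}:=\frac{A_3}{B_3}\in\mathcal F_{n_1+n_2}(R)$, where $$\begin{bmatrix}A_3&-V_3\\B_3&U_3\end{bmatrix}:=\begin{bmatrix}A_1&-V_1\\B_1&U_1\end{bmatrix}\cdot\begin{bmatrix}A_2&-V_2\\B_2&U_2\end{bmatrix}.$$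 This makes $\coprod_n\mathcal F_n(R)$ a monoid, functorially in $R$. A pointed naive homotopy from $f$ to $g$, for $f,g\in\coprod_n\mathcal F_n(k)$, is an element $F\in\coprod_n\mathcal F_n(k[T])$ with $F|_{T=0}=f$ and $F|_{T=1}=g$. Let $[\mathbf P^1,\mathbf P^1]^{\mathrm N}$ be the quotient of the set $\coprod_{n\ge0}\mathcal F_n(k)$ (the pointed endomorphisms of $\mathbf P^1$ over $k$, with base point $\infty$) by the equivalence relation generated by pointed naive homotopies. The law $\oplus^{\mathrm N}$ is compatible with this relation, so it makes $[\mathbf P^1,\mathbf P^1]^{\mathrm N}$ a monoid. **Statement.** For every field $k$: 1. $\oplus^{\mathrm N}$ is not commutative on $\mathcal F$: there are already $f,g\in\coprod_n\mathcal F_n(k)$ with $f\oplus^{\mathrm N}g\ne g\oplus^{\mathrm N}f$; 2. the induced monoid $\big([\mathbf P^1,\mathbf P^1]^{\mathrm N},\oplus^{\mathrm N}\big)$ is abelian. -/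

import Mathlib

open Polynomial

noncomputable section

/-- An `R`-point `A / B` of the scheme `𝓕 = ∐ₙ 𝓕ₙ` of pointed rational functions, of a given
degree `n = deg`: `A = Xⁿ + aₙ₋₁ Xⁿ⁻¹ + ⋯ + a₀`, `B = bₙ₋₁ Xⁿ⁻¹ + ⋯ + b₀`, and the resultant
`res_{n,n}(A, B)` is a unit of `R`. Here `𝓕₀(R)` is one point, `1 / 0`.
(`A` is monic of degree `n`; the condition is phrased with coefficients so that it is also the
right one over the zero ring.) -/
@[ext]
structure PointedRatFun (R : Type*) [CommRing R] where
  deg : ℕ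
  num : R[X]
  den : R[X]
  natDegree_num_le : num.natDegree ≤ deg
  coeff_num : num.coeff deg = 1
  degree_den_lt : den.degree < deg
  isUnit_resultant : IsUnit (num.resultant den deg deg)

namespace PointedRatFun

variable {R S : Type*} [CommRing R] [CommRing S]

theorem monic_num (f : PointedRatFun R) : f.num.Monic :=
  monic_of_natDegree_le_of_coeff_eq_one f.deg f.natDegree_num_le f.coeff_num

theorem degree_num [Nontrivial R] (f : PointedRatFun R) : f.num.degree = f.deg := by
  apply le_antisymm (natDegree_le_iff_degree_le.mp f.natDegree_num_le)
  apply le_degree_of_ne_zero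
  rw [f.coeff_num]
  exact one_ne_zero

theorem isUnit_resultant_iff {A B : R[X]} {n : ℕ} (hA : A.natDegree ≤ n) (hA' : A.coeff n = 1)
    (hB : B.natDegree ≤ n) : IsUnit (A.resultant B n n) ↔ IsCoprime A B := by
  rcases subsingleton_or_nontrivial R with hR | hR
  · exact ⟨fun _ => ⟨0, 0, Subsingleton.elim _ _⟩, fun _ => isUnit_of_subsingleton _⟩
  have hM : A.Monic := monic_of_natDegree_le_of_coeff_eq_one n hA hA'
  have hn : A.natDegree = n := le_antisymm hA (le_natDegree_of_ne_zero (by simp [hA']))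
  obtain ⟨k, rfl⟩ := Nat.exists_eq_add_of_le hB
  rw [resultant_add_right_deg A B _ _ k le_rfl, hA', one_pow, one_mul,
    ← isUnit_resultant_iff_isCoprime hM, hn]

/-- `(U, V)` is the pair of polynomials of the Bézout relation `A U + B V = 1` attached to
`f = A / B` of degree `n`: `deg U ≤ n - 2` and `deg V ≤ n - 1`. (For `n = 0`, where `A / B = 1 / 0`,
this means `(U, V) = (1, 0)`, and there is no bound on `U`.) -/
structure IsBezoutPair (f : PointedRatFun R) (U V : R[X]) : Prop where
  eq_one : f.num * U + f.den * V = 1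
  degree_left : 0 < f.deg → U.degree + 1 < f.deg
  degree_right : V.degree < f.deg

theorem degree_bezout_left (f : PointedRatFun R) {U V : R[X]} (h : f.num * U + f.den * V = 1)
    (hV : V.degree < f.deg) (hn : 0 < f.deg) : U.degree + 1 < f.deg := by
  nontriviality R
  by_cases hU : U = 0
  · simp [hU]
  have h1 : f.num * U = 1 - f.den * V := by linear_combination h
  have h2 : (f.num * U).natDegree = f.deg + U.natDegree := by
    rw [f.monic_num.natDegree_mul' hU, natDegree_eq_of_degree_eq_some f.degree_num]
  have h3 : f.den.natDegree + 1 ≤ f.deg := by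
    by_cases h0 : f.den = 0
    · simpa [h0, Nat.succ_le_iff] using hn
    · exact (natDegree_lt_iff_degree_lt h0).mpr f.degree_den_lt
  have h4 : V.natDegree + 1 ≤ f.deg := by
    by_cases h0 : V = 0
    · simpa [h0, Nat.succ_le_iff] using hn
    · exact (natDegree_lt_iff_degree_lt h0).mpr hV
  have h5 : (1 - f.den * V).natDegree ≤ f.den.natDegree + V.natDegree := by
    refine (natDegree_sub_le _ _).trans ?_
    simpa using natDegree_mul_le
  rw [← h1, h2] at h5
  rw [degree_eq_natDegree hU]
  exact_mod_cast (by omega : U.natDegree + 1 < f.deg)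

theorem isCoprime (f : PointedRatFun R) : IsCoprime f.num f.den :=
  (isUnit_resultant_iff f.natDegree_num_le f.coeff_num
    (natDegree_le_iff_degree_le.mpr f.degree_den_lt.le)).mp f.isUnit_resultant

theorem exists_isBezoutPair (f : PointedRatFun R) :
    ∃ UV : R[X] × R[X], f.IsBezoutPair UV.1 UV.2 := by
  rcases subsingleton_or_nontrivial R with hR | hR
  · refine ⟨(0, 0), Subsingleton.elim _ _, fun _ => ?_, ?_⟩ <;> simp
  obtain ⟨a, b, hab⟩ := f.isCoprime
  have hm := f.monic_num
  have h1 : f.num * (a + f.den * (b /ₘ f.num)) + f.den * (b %ₘ f.num) = 1 := by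
    linear_combination hab + f.den * modByMonic_add_div b f.num
  have h2 : (b %ₘ f.num).degree < f.deg := by
    rw [← f.degree_num]
    exact degree_modByMonic_lt _ hm
  exact ⟨(_, _), h1, fun hn => f.degree_bezout_left h1 h2 hn, h2⟩

theorem IsBezoutPair.unique {f : PointedRatFun R} {U V U' V' : R[X]}
    (h : f.IsBezoutPair U V) (h' : f.IsBezoutPair U' V') : U = U' ∧ V = V' := by
  nontriviality R
  have hm := f.monic_num
  have h1 : f.num ∣ V - V' := by
    refine f.isCoprime.dvd_of_dvd_mul_left ⟨U' - U, ?_⟩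
    linear_combination h.eq_one - h'.eq_one
  have hV : V = V' := by
    rw [← sub_eq_zero]
    by_contra hne
    refine hm.not_dvd_of_degree_lt hne ?_ h1
    rw [f.degree_num]
    exact (degree_sub_le _ _).trans_lt (max_lt h.degree_right h'.degree_right)
  subst hV
  refine ⟨?_, rfl⟩
  apply hm.isRegular.left
  change f.num * U = f.num * U'
  linear_combination h.eq_one - h'.eq_one

/-- The polynomial `U` of the Bézout relation `A U + B V = 1` attached to `A / B`. -/
def bezU (f : PointedRatFun R) : R[X] := f.exists_isBezoutPair.choose.1

/-- The polynomial `V` of the Bézout relation `A U + B V = 1` attached to `A / B`. -/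
def bezV (f : PointedRatFun R) : R[X] := f.exists_isBezoutPair.choose.2

theorem isBezoutPair (f : PointedRatFun R) : f.IsBezoutPair f.bezU f.bezV :=
  f.exists_isBezoutPair.choose_spec

theorem natDegree_bezU_le (f : PointedRatFun R) : f.bezU.natDegree ≤ f.deg := by
  nontriviality R
  rcases Nat.eq_zero_or_pos f.deg with h | h
  · have hA : f.num = 1 := by
      refine eq_one_of_monic_natDegree_zero f.monic_num ?_
      have := f.natDegree_num_le
      omega
    have hB : f.den = 0 := by
      have := f.degree_den_lt
      rw [h] at this
      exact degree_eq_bot.mp ((Nat.WithBot.lt_zero_iff).mp this)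
    have := f.isBezoutPair.eq_one
    rw [hA, hB] at this
    simp only [one_mul, zero_mul, add_zero] at this
    simp [this]
  · have h1 := f.isBezoutPair.degree_left h
    by_cases h0 : f.bezU = 0
    · simp [h0]
    · rw [degree_eq_natDegree h0] at h1
      have h2 : f.bezU.natDegree + 1 < f.deg := by exact_mod_cast h1
      omega

theorem degree_mul_lt_left {p q : R[X]} {a b : ℕ} (hp : p.degree < a) (hq : q.natDegree ≤ b) :
    (p * q).degree < (a + b : ℕ) := by
  by_cases h0 : p = 0
  · simp [h0]
  have h1 : p.natDegree < a := (natDegree_lt_iff_degree_lt h0).mpr hp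
  have h2 : (p * q).natDegree < a + b := natDegree_mul_le.trans_lt (by omega)
  exact degree_le_natDegree.trans_lt (by exact_mod_cast h2)

theorem degree_mul_lt_right {p q : R[X]} {a b : ℕ} (hp : p.natDegree ≤ a) (hq : q.degree < b) :
    (p * q).degree < (a + b : ℕ) := by
  rw [mul_comm, add_comm a b]
  exact degree_mul_lt_left hq hp

/-- The law `⊕ᴺ`: `A₁ / B₁ ⊕ᴺ A₂ / B₂ = A₃ / B₃`, where
`[A₃, -V₃; B₃, U₃] = [A₁, -V₁; B₁, U₁] * [A₂, -V₂; B₂, U₂]`. -/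
instance : Add (PointedRatFun R) where
  add f g :=
    { deg := f.deg + g.deg
      num := f.num * g.num - f.bezV * g.den
      den := f.den * g.num + f.bezU * g.den
      natDegree_num_le := by
        refine (natDegree_sub_le _ _).trans (max_le ?_ ?_)
        · exact natDegree_mul_le_of_le f.natDegree_num_le g.natDegree_num_le
        · exact natDegree_le_iff_degree_le.mpr (degree_mul_lt_left f.isBezoutPair.degree_right
            (natDegree_le_iff_degree_le.mpr g.degree_den_lt.le)).le
      coeff_num := by
        rw [coeff_sub, coeff_mul_add_eq_of_natDegree_le f.natDegree_num_le g.natDegree_num_le,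
          f.coeff_num, g.coeff_num, coeff_eq_zero_of_degree_lt (degree_mul_lt_left
            f.isBezoutPair.degree_right (natDegree_le_iff_degree_le.mpr g.degree_den_lt.le))]
        simp
      degree_den_lt := by
        refine (degree_add_le _ _).trans_lt (max_lt ?_ ?_)
        · exact degree_mul_lt_left f.degree_den_lt g.natDegree_num_le
        · exact degree_mul_lt_right f.natDegree_bezU_le g.degree_den_lt
      isUnit_resultant := by
        rw [isUnit_resultant_iff]
        · refine ⟨f.bezU * g.bezU - f.den * g.bezV, f.num * g.bezV + f.bezV * g.bezU, ?_⟩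
          linear_combination (g.num * g.bezU + g.den * g.bezV) * f.isBezoutPair.eq_one +
            g.isBezoutPair.eq_one
        · refine (natDegree_sub_le _ _).trans (max_le ?_ ?_)
          · exact natDegree_mul_le_of_le f.natDegree_num_le g.natDegree_num_le
          · exact natDegree_le_iff_degree_le.mpr (degree_mul_lt_left f.isBezoutPair.degree_right
              (natDegree_le_iff_degree_le.mpr g.degree_den_lt.le)).le
        · rw [coeff_sub, coeff_mul_add_eq_of_natDegree_le f.natDegree_num_le g.natDegree_num_le,
            f.coeff_num, g.coeff_num, coeff_eq_zero_of_degree_lt (degree_mul_lt_left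
              f.isBezoutPair.degree_right (natDegree_le_iff_degree_le.mpr g.degree_den_lt.le))]
          simp
        · refine natDegree_le_iff_degree_le.mpr
            ((degree_add_le _ _).trans_lt (max_lt ?_ ?_)).le
          · exact degree_mul_lt_left f.degree_den_lt g.natDegree_num_le
          · exact degree_mul_lt_right f.natDegree_bezU_le g.degree_den_lt }

theorem deg_add (f g : PointedRatFun R) : (f + g).deg = f.deg + g.deg := rfl

theorem num_add (f g : PointedRatFun R) :
    (f + g).num = f.num * g.num - f.bezV * g.den := rfl

theorem den_add (f g : PointedRatFun R) :
    (f + g).den = f.den * g.num + f.bezU * g.den := rfl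

theorem bez_add (f g : PointedRatFun R) :
    (f + g).bezU = f.bezU * g.bezU - f.den * g.bezV ∧
      (f + g).bezV = f.num * g.bezV + f.bezV * g.bezU := by
  have h1 : (f + g).num * (f.bezU * g.bezU - f.den * g.bezV) +
      (f + g).den * (f.num * g.bezV + f.bezV * g.bezU) = 1 := by
    rw [num_add, den_add]
    linear_combination (g.num * g.bezU + g.den * g.bezV) * f.isBezoutPair.eq_one +
      g.isBezoutPair.eq_one
  have h2 : (f.num * g.bezV + f.bezV * g.bezU).degree < (f + g).deg := by
    refine (degree_add_le _ _).trans_lt (max_lt ?_ ?_)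
    · exact degree_mul_lt_right f.natDegree_num_le g.isBezoutPair.degree_right
    · exact degree_mul_lt_left f.isBezoutPair.degree_right g.natDegree_bezU_le
  exact (f + g).isBezoutPair.unique ⟨h1, fun hn => degree_bezout_left _ h1 h2 hn, h2⟩

/-- The point `1 / 0` of degree `0`. -/
instance : Zero (PointedRatFun R) where
  zero :=
    { deg := 0
      num := 1
      den := 0
      natDegree_num_le := by simp
      coeff_num := by simp
      degree_den_lt := by simp
      isUnit_resultant := by simp }

theorem bez_zero : (0 : PointedRatFun R).bezU = 1 ∧ (0 : PointedRatFun R).bezV = 0 := by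
  refine (0 : PointedRatFun R).isBezoutPair.unique ⟨?_, fun h => absurd h (lt_irrefl 0), ?_⟩
  · change (1 : R[X]) * 1 + 0 * 0 = 1
    ring
  · simp

/-- `(𝓕(R), ⊕ᴺ)` is a monoid. -/
instance : AddMonoid (PointedRatFun R) where
  add_assoc f g h := by
    ext1
    · exact Nat.add_assoc _ _ _
    · rw [num_add, num_add, num_add f, num_add, den_add, (bez_add f g).2]
      ring
    · rw [den_add, den_add, den_add f, num_add, den_add, (bez_add f g).1]
      ring
  zero_add f := by
    ext1
    · exact Nat.zero_add _
    · rw [num_add, bez_zero.2]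
      change 1 * f.num - 0 * f.den = f.num
      ring
    · rw [den_add, bez_zero.1]
      change 0 * f.num + 1 * f.den = f.den
      ring
  add_zero f := by
    ext1
    · rfl
    · rw [num_add]
      change f.num * 1 - f.bezV * 0 = f.num
      ring
    · rw [den_add]
      change f.den * 1 + f.bezU * 0 = f.den
      ring
  nsmul := nsmulRec

/-- Functoriality of the points of `𝓕`: apply a ring morphism to the coefficients. -/
def map (φ : R →+* S) (f : PointedRatFun R) : PointedRatFun S where
  deg := f.deg
  num := f.num.map φ
  den := f.den.map φ
  natDegree_num_le := natDegree_map_le.trans f.natDegree_num_le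
  coeff_num := by rw [coeff_map, f.coeff_num, map_one]
  degree_den_lt := degree_map_le.trans_lt f.degree_den_lt
  isUnit_resultant := by
    rw [resultant_map_map]
    exact f.isUnit_resultant.map φ

theorem bez_map (φ : R →+* S) (f : PointedRatFun R) :
    (f.map φ).bezU = f.bezU.map φ ∧ (f.map φ).bezV = f.bezV.map φ := by
  have h1 : (f.map φ).num * f.bezU.map φ + (f.map φ).den * f.bezV.map φ = 1 := by
    change f.num.map φ * f.bezU.map φ + f.den.map φ * f.bezV.map φ = 1
    rw [← Polynomial.map_mul, ← Polynomial.map_mul, ← Polynomial.map_add, f.isBezoutPair.eq_one,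
      Polynomial.map_one]
  have h2 : (f.bezV.map φ).degree < (f.map φ).deg :=
    degree_map_le.trans_lt f.isBezoutPair.degree_right
  exact (f.map φ).isBezoutPair.unique ⟨h1, fun hn => degree_bezout_left _ h1 h2 hn, h2⟩

theorem map_add (φ : R →+* S) (f g : PointedRatFun R) : (f + g).map φ = f.map φ + g.map φ := by
  ext1
  · rfl
  · rw [num_add, (bez_map φ f).2]
    change (f.num * g.num - f.bezV * g.den).map φ = _
    simp [map]
  · rw [den_add, (bez_map φ f).1]
    change (f.den * g.num + f.bezU * g.den).map φ = _
    simp [map]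

theorem map_eval_map_C (r : R) (f : PointedRatFun R) : (f.map C).map (evalRingHom r) = f := by
  have h : (evalRingHom r).comp C = RingHom.id R := by ext; simp
  ext1
  · rfl
  · simp [map, Polynomial.map_map, h]
  · simp [map, Polynomial.map_map, h]

/-- There is a pointed naive homotopy, that is, an element `F ∈ 𝓕(R[T])`, with source
`F|_{T = 0} = f` and target `F|_{T = 1} = g`. -/
def NaiveHomotopy (f g : PointedRatFun R) : Prop :=
  ∃ F : PointedRatFun R[X], F.map (evalRingHom 0) = f ∧ F.map (evalRingHom 1) = g

theorem NaiveHomotopy.add_right {f f' : PointedRatFun R} (h : NaiveHomotopy f f')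
    (g : PointedRatFun R) : NaiveHomotopy (f + g) (f' + g) := by
  obtain ⟨F, rfl, rfl⟩ := h
  exact ⟨F + g.map C, by rw [map_add, map_eval_map_C], by rw [map_add, map_eval_map_C]⟩

theorem NaiveHomotopy.add_left {g g' : PointedRatFun R} (f : PointedRatFun R)
    (h : NaiveHomotopy g g') : NaiveHomotopy (f + g) (f + g') := by
  obtain ⟨G, rfl, rfl⟩ := h
  exact ⟨f.map C + G, by rw [map_add, map_eval_map_C], by rw [map_add, map_eval_map_C]⟩

/-- The equivalence relation generated by pointed naive homotopies (two functions are related when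
a finite chain of homotopies joins them), which is compatible with `⊕ᴺ`. -/
def naiveCon (R : Type*) [CommRing R] : AddCon (PointedRatFun R) where
  toSetoid := Relation.EqvGen.setoid NaiveHomotopy
  add' {f f' g g'} hf hg := by
    have h1 : Relation.EqvGen NaiveHomotopy (f + g) (f' + g) := by
      induction hf with
      | rel _ _ h => exact .rel _ _ (h.add_right g)
      | refl _ => exact .refl _
      | symm _ _ _ ih => exact .symm _ _ ih
      | trans _ _ _ _ _ ih ih' => exact .trans _ _ _ ih ih'
    have h2 : Relation.EqvGen NaiveHomotopy (f' + g) (f' + g') := by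
      clear h1 hf
      induction hg with
      | rel _ _ h => exact .rel _ _ (h.add_left f')
      | refl _ => exact .refl _
      | symm _ _ _ ih => exact .symm _ _ ih
      | trans _ _ _ _ _ ih ih' => exact .trans _ _ _ ih ih'
    exact .trans _ _ _ h1 h2

end PointedRatFun

/-- The monoid `([P¹, P¹]ᴺ, ⊕ᴺ)` of pointed naive homotopy classes of pointed endomorphisms of
`P¹` over `k`: the quotient of `∐ₙ 𝓕ₙ(k)` by the equivalence relation generated by pointed naive
homotopies, with the law induced by `⊕ᴺ`. -/
abbrev P1P1Naive (k : Type*) [Field k] : Type _ :=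
  (PointedRatFun.naiveCon k).Quotient

end

open Polynomial

noncomputable section

namespace PointedRatFun

section Construction

variable {R : Type*} [CommRing R]

/-! The monoid of classes is generated by the classes of `X / b`, `b` a unit, and these commute with
one another.

Generation: the Euclidean algorithm on `(A, B)` is a decomposition under `⊕ᴺ`, since `A / b`
contributes the matrix `[A, -1/b; b, 0]`. Thus `f` is a polynomial function plus a function of
degree `deg B` (`exists_eq_ofPoly_add`). A polynomial function `A / b` of degree `n ≥ 2` that cannot
be split in this way is homotopic to `Xⁿ / b`, and then to `Xⁿ / (Xⁿ⁻¹ + b)`, whose expansion has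
pieces of degrees `1` and `n - 1`. Induction on the degree concludes (`naiveClass_mem_closure`).

Commutation: `X / a ⊕ᴺ X / b` has the diagonal Bézout form `⟨b, a⟩`. A polynomial path in `SL₂` from
the identity to a quarter turn carries it to `⟨a, b⟩` with constant determinant, and the path of
forms lifts to a path of functions of degree two (`naiveHomotopy_linear_add_comm`). -/

/-- The pointed rational function `A / B` of degree `n` given by coprime polynomials. -/
def ofCoprime (n : ℕ) (A B : R[X]) (hA : A.natDegree ≤ n) (hA' : A.coeff n = 1)
    (hB : B.degree < n) (h : IsCoprime A B) : PointedRatFun R where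
  deg := n
  num := A
  den := B
  natDegree_num_le := hA
  coeff_num := hA'
  degree_den_lt := hB
  isUnit_resultant :=
    (isUnit_resultant_iff hA hA' (natDegree_le_iff_degree_le.mpr hB.le)).mpr h

theorem isCoprime_C_right (A : R[X]) {b : R} (hb : IsUnit b) : IsCoprime A (C b) :=
  isCoprime_one_right.of_isCoprime_of_dvd_right ((hb.map C).dvd)

theorem degree_C_lt_of_pos {n : ℕ} (hn : 0 < n) (b : R) : (C b).degree < n :=
  degree_C_le.trans_lt (by exact_mod_cast hn)

/-- The polynomial function `A / b`, for a monic polynomial `A` of positive degree and a unit `b`. -/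
def ofPoly (n : ℕ) (hn : 0 < n) (A : R[X]) (hA : A.natDegree ≤ n) (hA' : A.coeff n = 1)
    (b : Rˣ) : PointedRatFun R :=
  ofCoprime n A (C (b : R)) hA hA' (degree_C_lt_of_pos hn _) (isCoprime_C_right A b.isUnit)

/-- With `U = 0`, adding `A / b` on the left is multiplication by `[A, -1/b; b, 0]`, one step of the
Euclidean algorithm. -/
theorem bez_ofPoly (n : ℕ) (hn : 0 < n) (A : R[X]) (hA : A.natDegree ≤ n) (hA' : A.coeff n = 1)
    (b : Rˣ) : (ofPoly n hn A hA hA' b).bezU = 0 ∧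
      (ofPoly n hn A hA hA' b).bezV = C ((b⁻¹ : Rˣ) : R) := by
  have h1 : (ofPoly n hn A hA hA' b).num * 0 +
      (ofPoly n hn A hA hA' b).den * C ((b⁻¹ : Rˣ) : R) = 1 := by
    change A * 0 + C (b : R) * C ((b⁻¹ : Rˣ) : R) = 1
    rw [← C_mul]
    simp
  have h2 : (C ((b⁻¹ : Rˣ) : R)).degree < (ofPoly n hn A hA hA' b).deg := degree_C_lt_of_pos hn _
  exact (isBezoutPair _).unique ⟨h1, fun h => degree_bezout_left _ h1 h2 h, h2⟩

/-- The function `X / b` of degree one. -/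
def linear (b : Rˣ) : PointedRatFun R :=
  ofPoly 1 one_pos X natDegree_X_le coeff_X_one b

/-! ### Functions of degree two and commutation of the generators. -/

/-- Dividing `r² (X² + p X + q)` by `r X + s` leaves the quotient `r X + p r - s` and this unit as
remainder; no division by `r` is needed. -/
theorem isUnit_natDegree_two_coprime {p q r s : R} (h : IsUnit (s ^ 2 - p * s * r + q * r ^ 2)) :
    IsCoprime (X ^ 2 + C p * X + C q) (C r * X + C s) := by
  obtain ⟨d, hd⟩ := h
  have hd' : C ((d⁻¹ : Rˣ) : R) * (C s ^ 2 - C p * C s * C r + C q * C r ^ 2) = 1 := by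
    rw [← C_1, ← d.inv_mul, hd]
    simp
  refine ⟨C ((d⁻¹ : Rˣ) : R) * C r ^ 2, -C ((d⁻¹ : Rˣ) : R) * (C r * X + C p * C r - C s), ?_⟩
  linear_combination hd'

/-- The function `(X² + p X + q) / (r X + s)` of degree two. -/
def quadratic (p q r s : R) (h : IsUnit (s ^ 2 - p * s * r + q * r ^ 2)) : PointedRatFun R :=
  ofCoprime 2 (X ^ 2 + C p * X + C q) (C r * X + C s) (by compute_degree) (by compute_degree!)
    (degree_linear_lt) (isUnit_natDegree_two_coprime h)

theorem map_quadratic {S : Type*} [CommRing S] (φ : R →+* S) (p q r s : R)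
    (h : IsUnit (s ^ 2 - p * s * r + q * r ^ 2))
    (h' : IsUnit (φ s ^ 2 - φ p * φ s * φ r + φ q * φ r ^ 2)) :
    (quadratic p q r s h).map φ = quadratic (φ p) (φ q) (φ r) (φ s) h' := by
  ext1
  · rfl
  · simp [map, quadratic, ofCoprime]
  · simp [map, quadratic, ofCoprime]

theorem linear_add_linear (a b : Rˣ) (h) :
    linear a + linear b = quadratic 0 (-((a⁻¹ : Rˣ) : R) * b) a 0 h := by
  ext1
  · rfl
  · rw [num_add, linear, (bez_ofPoly ..).2]
    simp only [linear, ofPoly, ofCoprime, quadratic, C_mul, C_neg, C_0]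
    ring
  · rw [den_add, linear, (bez_ofPoly ..).1]
    simp only [linear, ofPoly, ofCoprime, quadratic, C_0]
    ring

/-- A path in `SL₂` from the identity to a quarter turn, acting on the Bézout form `⟨b, a⟩` of
`X / a ⊕ᴺ X / b`, transforms it into `⟨a, b⟩`. -/
theorem naiveHomotopy_linear_add_comm (a b : Rˣ) :
    NaiveHomotopy (linear a + linear b) (linear b + linear a) := by
  -- Here `X` is the homotopy parameter. The path is `M = [u, -X; w, u] = [1, 0; X, 1] * [1, -X; 0,
  -- 1] * [1, 0; X, 1]`, of determinant `u² + X w = 1`, and `[P, Q; Q, S] = M * diag(y, x) * Mᵀ`.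
  let u : R[X] := 1 - X ^ 2
  let w : R[X] := 2 * X - X ^ 3
  let x : R[X] := C (a : R)
  let y : R[X] := C (b : R)
  let x' : R[X] := C ((a⁻¹ : Rˣ) : R)
  let y' : R[X] := C ((b⁻¹ : Rˣ) : R)
  have hx : x * x' = 1 := by simp only [x, x']; rw [← C_mul]; simp
  have hy : y * y' = 1 := by simp only [y, y']; rw [← C_mul]; simp
  let P : R[X] := y * u ^ 2 + x * X ^ 2
  let Q : R[X] := y * u * w - x * X * u
  let S : R[X] := y * w ^ 2 + x * u ^ 2
  have huw : u ^ 2 + X * w = 1 := by simp only [u, w]; ring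
  have hdet : P * S - Q ^ 2 = x * y := by
    simp only [P, S, Q]
    linear_combination x * y * (u ^ 2 + X * w + 1) * huw
  have hF : Q ^ 2 - (-P * Q * x' * y') * Q * S + (-P ^ 2 * x' * y') * S ^ 2 = -(x * y) := by
    linear_combination (-1 - P * S * x' * y') * hdet - P * S * y * y' * hx - P * S * hy
  have hU : IsUnit (-(x * y)) := by
    simp [x, y]
  -- The Bézout form of `(X² + p X + q) / (r X + s)` is `[p s - q r, s; s, r]`. So `r = S`, `s = Q`,
  -- and `p Q - q S = P` is solved by means of `P S - Q² = x y`. The resultant is then the constant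
  -- `-x y`.
  refine ⟨quadratic (-P * Q * x' * y') (-P ^ 2 * x' * y') S Q (hF ▸ hU), ?_, ?_⟩
  · rw [linear_add_linear a b (by simp [← mul_assoc, pow_two]), map_quadratic]
    · congr 1 <;> simp [P, Q, S, u, w, x, y, x', y', pow_two]
      linear_combination (((a⁻¹ : Rˣ) : R) * b) * b.mul_inv
    · simp [P, Q, S, u, w, x, y, x', y', pow_two]
  · rw [linear_add_linear b a (by simp), map_quadratic]
    · congr 1 <;> norm_num [P, Q, S, u, w, x, y, x', y', pow_two]
      exact mul_comm _ _
    · norm_num [P, Q, S, u, w, x, y, x', y', pow_two]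

/-! ### Deformations of polynomial functions. -/

theorem evalRingHom_comp_C_eq_id (r : R) : (evalRingHom r).comp C = RingHom.id R := by
  ext
  simp

/-- Over a constant unit denominator every monic numerator is allowed, so the straight line from `A`
to `A'` is a homotopy. -/
theorem naiveHomotopy_ofPoly (n : ℕ) (hn : 0 < n) (A A' : R[X]) (hA : A.natDegree ≤ n)
    (hA1 : A.coeff n = 1) (hA' : A'.natDegree ≤ n) (hA1' : A'.coeff n = 1) (b : Rˣ) :
    NaiveHomotopy (ofPoly n hn A hA hA1 b) (ofPoly n hn A' hA' hA1' b) := by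
  have h (B : R[X]) (hB : B.natDegree ≤ n) : (B.map (C : R →+* R[X])).natDegree ≤ n :=
    natDegree_map_le.trans hB
  refine ⟨ofPoly n hn (A.map C + C X * (A'.map C - A.map C)) ?_ ?_ (b.map C.toMonoidHom), ?_, ?_⟩
  · refine (natDegree_add_le _ _).trans (max_le (h A hA) ((natDegree_C_mul_le _ _).trans ?_))
    exact (natDegree_sub_le _ _).trans (max_le (h A' hA') (h A hA))
  · simp [hA1, hA1']
  · ext1
    · rfl
    · simp [map, ofPoly, ofCoprime, Polynomial.map_map, evalRingHom_comp_C_eq_id]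
    · simp [map, ofPoly, ofCoprime]
  · ext1
    · rfl
    · simp [map, ofPoly, ofCoprime, Polynomial.map_map, evalRingHom_comp_C_eq_id]
    · simp [map, ofPoly, ofCoprime]

theorem isCoprime_X_pow (n m : ℕ) (t : R) (b : Rˣ) :
    IsCoprime (X ^ n : R[X]) (C t * X ^ (m + 1) + C (b : R)) := by
  refine IsCoprime.pow_left ⟨-C ((b⁻¹ : Rˣ) : R) * C t * X ^ m, C ((b⁻¹ : Rˣ) : R), ?_⟩
  have : C ((b⁻¹ : Rˣ) : R) * C (b : R) = 1 := by rw [← C_mul]; simp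
  linear_combination this

/-- The function `Xⁿ⁺² / (t Xⁿ⁺¹ + b)`. -/
def powDiv (n : ℕ) (t : R) (b : Rˣ) : PointedRatFun R :=
  ofCoprime (n + 2) (X ^ (n + 2)) (C t * X ^ (n + 1) + C (b : R)) (natDegree_X_pow_le _)
    (by simp)
    ((degree_add_le _ _).trans_lt (max_lt ((degree_C_mul_X_pow_le _ _).trans_lt
      (by exact_mod_cast Nat.lt_succ_self _)) (degree_C_lt_of_pos (by omega) _)))
    (isCoprime_X_pow _ _ t b)

/-- Letting `t` run from `0` to `1` keeps the denominator coprime to `X`, its constant term being a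
unit. The target has a nonconstant denominator, so its Euclidean algorithm takes more than one step.
-/
theorem naiveHomotopy_powDiv (n : ℕ) (b : Rˣ) :
    NaiveHomotopy (ofPoly (n + 2) (by omega) (X ^ (n + 2)) (natDegree_X_pow_le _) (by simp) b)
      (powDiv n 1 b) := by
  refine ⟨powDiv n X (b.map C.toMonoidHom), ?_, ?_⟩ <;> ext1
  · rfl
  · simp [map, powDiv, ofPoly, ofCoprime]
  · simp [map, powDiv, ofPoly, ofCoprime]
  · rfl
  · simp [map, powDiv, ofCoprime]
  · simp [map, powDiv, ofCoprime]

end Construction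

/-! ### Continued fractions over a field and generation by the `X / b`. -/

section Field

variable {k : Type*} [Field k]

/-- The first step of the continued fraction expansion of a pointed rational function. -/
theorem exists_eq_ofPoly_add (f : PointedRatFun k) (hf : f.den ≠ 0) :
    ∃ (n : ℕ) (hn : 0 < n) (A : k[X]) (hA : A.natDegree ≤ n) (hA' : A.coeff n = 1) (b : kˣ)
      (g : PointedRatFun k), f = ofPoly n hn A hA hA' b + g ∧ g.deg = f.den.natDegree := by
  obtain ⟨m, hm⟩ : ∃ m, f.den.natDegree = m := ⟨_, rfl⟩
  have hmn : m < f.deg := hm ▸ (natDegree_lt_iff_degree_lt hf).mpr f.degree_den_lt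
  obtain ⟨n, hn⟩ := Nat.exists_eq_add_of_lt hmn
  let b : kˣ := Units.mk0 f.den.leadingCoeff (leadingCoeff_ne_zero.mpr hf)
  let D : k[X] := C ((b⁻¹ : kˣ) : k) * f.den
  have hD : D.Monic := by
    simp only [D, b, Monic, leadingCoeff_mul, leadingCoeff_C]
    simp [hf]
  have hbb : C (b : k) * C ((b⁻¹ : kˣ) : k) = 1 := by rw [← C_mul]; simp
  have hbD : C (b : k) * D = f.den := by
    simp only [D]
    linear_combination f.den * hbb
  have hDm : D.natDegree = m := by
    simp only [D]
    rw [natDegree_C_mul (Units.ne_zero _), hm]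
  have hnum : f.num.natDegree = f.deg := natDegree_eq_of_degree_eq_some f.degree_num
  have hdiv := modByMonic_add_div f.num D
  have hA1 : (f.num /ₘ D).natDegree = n + 1 := by
    rw [natDegree_divByMonic _ hD, hDm, hnum]
    omega
  have hA2 : (f.num /ₘ D).Monic := by
    refine (leadingCoeff_divByMonic_of_monic hD ?_).trans f.monic_num
    rw [f.degree_num, degree_eq_natDegree hD.ne_zero, hDm]
    exact_mod_cast hmn.le
  have hR : (f.num %ₘ D).degree < m := by
    rw [← hDm, ← degree_eq_natDegree hD.ne_zero]
    exact degree_modByMonic_lt _ hD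
  have hco : IsCoprime D (-C (b : k) * (f.num %ₘ D)) := by
    obtain ⟨s, t, hst⟩ := f.isCoprime
    refine ⟨s * (f.num /ₘ D) + t * C (b : k), -C ((b⁻¹ : kˣ) : k) * s, ?_⟩
    linear_combination hst + s * hdiv + t * hbD + s * (f.num %ₘ D) * hbb
  -- With `f.den = b D` and `f.num = D A + R`, the remaining function is `D / (-b R)`, because `[A,
  -- -1/b; b, 0]` sends the column `(D, -b R)` to `(A D + R, b D)`.
  refine ⟨n + 1, n.succ_pos, f.num /ₘ D, hA1.le, ?_, b,
    ofCoprime m D (-C (b : k) * (f.num %ₘ D)) hDm.le (hDm ▸ hD) ?_ hco, ?_, hm.symm⟩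
  · rw [← hA1]
    exact hA2
  · rw [← C_neg]
    rwa [degree_C_mul (neg_ne_zero.mpr b.ne_zero)]
  · ext1
    · rw [deg_add, hn]
      change m + n + 1 = n + 1 + m
      ring
    · rw [num_add, (bez_ofPoly ..).2]
      simp only [ofPoly, ofCoprime]
      linear_combination -hdiv - (f.num %ₘ D) * hbb
    · rw [den_add, (bez_ofPoly ..).1]
      simp only [ofPoly, ofCoprime]
      linear_combination -hbD

theorem eq_zero_of_deg_eq_zero (f : PointedRatFun k) (hf : f.deg = 0) : f = 0 := by
  ext1
  · exact hf
  · have := f.natDegree_num_le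
    exact eq_one_of_monic_natDegree_zero f.monic_num (by omega)
  · have := f.degree_den_lt
    rw [hf] at this
    exact degree_eq_bot.mp (Nat.WithBot.lt_zero_iff.mp this)

theorem den_ne_zero (f : PointedRatFun k) (hf : 0 < f.deg) : f.den ≠ 0 := by
  intro h
  have h1 := f.isCoprime
  rw [h, isCoprime_zero_right] at h1
  have h2 := natDegree_eq_zero_of_isUnit h1
  rw [natDegree_eq_of_degree_eq_some f.degree_num] at h2
  omega

/-- The pointed naive homotopy class of a pointed rational function. -/
def naiveClass : PointedRatFun k →+ P1P1Naive k := (naiveCon k).mk'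

theorem naiveClass_eq {f g : PointedRatFun k} (h : NaiveHomotopy f g) :
    naiveClass f = naiveClass g :=
  (AddCon.eq _).mpr (Relation.EqvGen.rel _ _ h)

/-- Every class is a sum of classes of functions `X / b`. -/
theorem naiveClass_mem_closure (f : PointedRatFun k) :
    naiveClass f ∈ AddSubmonoid.closure (Set.range fun b : kˣ => naiveClass (linear b)) := by
  obtain ⟨n, hn⟩ : ∃ n, f.deg = n := ⟨_, rfl⟩
  induction n using Nat.strong_induction_on generalizing f with
  | _ n ih =>
    subst hn
    rcases Nat.eq_zero_or_pos f.deg with h0 | hpos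
    · rw [eq_zero_of_deg_eq_zero f h0, _root_.map_zero]
      exact zero_mem _
    obtain ⟨n, hn, A, hA, hA', b, g, hfg, hg⟩ := exists_eq_ofPoly_add f (f.den_ne_zero hpos)
    have hdeg : f.deg = n + g.deg := by rw [hfg]; rfl
    rw [hfg, _root_.map_add]
    refine add_mem ?_ (ih _ (by omega) g rfl)
    -- If `g` has positive degree, the polynomial piece has smaller degree than `f`. Otherwise it
    -- has the full degree and must be deformed before the induction hypothesis applies.
    rcases Nat.eq_zero_or_pos g.deg with hg0 | hgpos
    · obtain rfl | ⟨m, rfl⟩ : n = 1 ∨ ∃ m, n = m + 2 := by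
        rcases n with _ | _ | m
        · omega
        · exact .inl rfl
        · exact .inr ⟨m, rfl⟩
      · rw [naiveClass_eq (naiveHomotopy_ofPoly 1 hn A X hA hA' natDegree_X_le coeff_X_one b)]
        exact AddSubmonoid.subset_closure ⟨b, rfl⟩
      · rw [naiveClass_eq (naiveHomotopy_ofPoly (m + 2) hn A (X ^ (m + 2)) hA hA'
          (natDegree_X_pow_le _) (by simp) b), naiveClass_eq (naiveHomotopy_powDiv m b)]
        -- This forces `g'.deg = m + 1` and `n' = 1`, both less than `m + 2`.
        have hd : (powDiv m 1 b).den.natDegree = m + 1 := by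
          simp only [powDiv, ofCoprime]
          compute_degree!
        obtain ⟨n', hn', A', hA1, hA1', b', g', hfg', hg'⟩ := exists_eq_ofPoly_add (powDiv m 1 b)
          (den_ne_zero _ (Nat.succ_pos _))
        have hdeg' : m + 2 = n' + g'.deg := by
          change (powDiv m 1 b).deg = _
          rw [hfg']
          rfl
        rw [hfg', _root_.map_add]
        exact add_mem (ih n' (by omega) _ rfl) (ih _ (by omega) g' rfl)
    · exact ih n (by omega) _ rfl

end Field

end PointedRatFun

end

/-! ### Noncommutativity on functions, commutativity on classes. -/

open PointedRatFun in
theorem corollary3p2 (k : Type*) [Field k] :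
    (¬ ∀ f g : PointedRatFun k, f + g = g + f) ∧
      ∀ x y : P1P1Naive k, x + y = y + x := by
  constructor
  · intro h
    -- For `X / 1` and `(X + 1) / 1` the denominators of the two sums are `X + 1` and `X`.
    have h1 := congrArg PointedRatFun.den (h (linear 1)
      (ofPoly 1 one_pos (X + 1) (by compute_degree) (by simp [coeff_one]) 1))
    rw [den_add, den_add, linear, (bez_ofPoly ..).1, (bez_ofPoly ..).1] at h1
    simp [ofPoly, ofCoprime] at h1
  · intro x y
    have hmem (z : P1P1Naive k) :
        z ∈ AddSubmonoid.closure (Set.range fun b : kˣ => naiveClass (linear b)) := by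
      induction z using AddCon.induction_on with
      | H f => exact naiveClass_mem_closure f
    refine AddSubmonoid.closure_induction₂ (motive := fun x y _ _ => x + y = y + x)
      ?_ ?_ ?_ ?_ ?_ (hmem x) (hmem y)
    · rintro _ _ ⟨a, rfl⟩ ⟨b, rfl⟩
      simp only [← _root_.map_add]
      exact naiveClass_eq (naiveHomotopy_linear_add_comm a b)
    · intro x _
      rw [zero_add, add_zero]
    · intro x _
      rw [zero_add, add_zero]
    · intro x y z _ _ _ h1 h2
      rw [add_assoc, h2, ← add_assoc, h1, add_assoc]
    · intro x y z _ _ _ h1 h2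
      rw [← add_assoc, h1, add_assoc, h2, add_assoc]
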